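/- Let $R$ be a prime ring that is left and right noetherian, with (right, Gabriel–Rentschler) Krull dimension $\dim R = n$ for some finite integer $n \ge 0$, and let $m$ be an integer with $0 \le m \le n$. Here $\dim M$ denotes the Krull dimension of a right $R$-module $M$, i.e. the deviation of its lattice of submodules, with $\dim 0 < 0$. Let $X = \{p \in \operatorname{Spec} R : \dim R/p = m\}$ be the full set of $m$-prime ideals of $R$. For an ideal $A$ of $R$ let $C(A)$ be the set of elements of $R$ that are regular modulo $A$ (neither left nor right zero divisors in $R/A$), and let $V = C(X) = \bigcap_{p \in X} C(p)$. Define the following families of right ideals of $R$: $$w = \{ I : R/I \text{ is } V\text{-torsion, i.e. for every } x \in R/I \text{ there is } t \in V \text{ with } xt = 0 \},$$ $$k = \{ I : I \cap V \neq \emptyset \}, \qquad g = \{ I : \dim R/I < m \}.$$ Then: (a) $w \subseteq k$. (b) If in addition $R$ is right fully bounded (for every prime ideal $p$, every essential right ideal of $R/p$ contains a two-sided ideal of $R/p$ that is essential as a right ideal), then $k \subseteq g$. -/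

import Mathlib

/-! Right modules over `R` are modules over `Rᵐᵒᵖ`, so that the right ideals of `R` are the elements
of `Submodule Rᵐᵒᵖ R`. -/

namespace RightFBN

/-- `DevLT k x y`: the interval `[x, y]` of a partially ordered set has deviation `< k`
(`k` a natural number). Deviation `< 0` means that the interval is trivial (deviation `-1`), and
deviation `< k + 1` means that in every infinite descending chain in the interval all but finitely
many of the factors `[f (i + 1), f i]` have deviation `< k`. -/
def DevLT {P : Type*} [PartialOrder P] : ℕ → P → P → Prop
  | 0, x, y => x = y
  | k + 1, x, y => ∀ f : ℕ → P, Antitone f → (∀ i, x ≤ f i ∧ f i ≤ y) →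
      ∃ N, ∀ i, N ≤ i → DevLT k (f (i + 1)) (f i)

/-- The (Gabriel-Rentschler) Krull dimension of the right `R`-module `M`, that is, the deviation of
its lattice of submodules, exists and is `< k`. -/
def KrullDimLT (R : Type*) [Ring R] (M : Type*) [AddCommGroup M] [Module Rᵐᵒᵖ M] (k : ℕ) : Prop :=
  DevLT k (⊥ : Submodule Rᵐᵒᵖ M) ⊤

/-- The (Gabriel-Rentschler) Krull dimension of the right `R`-module `M` exists and is equal to
the natural number `k`. -/
def HasKrullDim (R : Type*) [Ring R] (M : Type*) [AddCommGroup M] [Module Rᵐᵒᵖ M] (k : ℕ) : Prop :=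
  KrullDimLT R M (k + 1) ∧ ¬ KrullDimLT R M k

variable {R : Type*} [Ring R]

/-- A two-sided ideal regarded as a right ideal. -/
def toRightIdeal (A : TwoSidedIdeal R) : Submodule Rᵐᵒᵖ R where
  carrier := {x | x ∈ A}
  add_mem' := fun ha hb => A.add_mem ha hb
  zero_mem' := A.zero_mem
  smul_mem' := fun c _ hx => A.mul_mem_right _ c.unop hx

/-- Prime ideals of a (not necessarily commutative) ring: `p` is proper, and `a R b ⊆ p` implies
`a ∈ p` or `b ∈ p`. -/
def IsPrimeIdeal (p : TwoSidedIdeal R) : Prop :=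
  p ≠ ⊤ ∧ ∀ a b : R, (∀ r : R, a * r * b ∈ p) → a ∈ p ∨ b ∈ p

/-- A right ideal is essential if it meets every nonzero right ideal nontrivially. -/
def IsEssentialRightIdeal (I : Submodule Rᵐᵒᵖ R) : Prop :=
  ∀ J : Submodule Rᵐᵒᵖ R, J ≠ ⊥ → I ⊓ J ≠ ⊥

/-- `c(A)`: the elements of `R` that are regular modulo the two-sided ideal `A`. -/
def regularModulo (A : TwoSidedIdeal R) : Set R :=
  {c | ∀ r : R, (c * r ∈ A → r ∈ A) ∧ (r * c ∈ A → r ∈ A)}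

variable (R)

/-- `R` is a prime ring: its zero ideal is prime. -/
def IsPrimeRing : Prop := IsPrimeIdeal (⊥ : TwoSidedIdeal R)

/-- `R` is a noetherian ring (on both sides). -/
def IsTwoSidedNoetherian : Prop := IsNoetherianRing R ∧ IsNoetherianRing Rᵐᵒᵖ

/-- `R` is right bounded: every essential right ideal contains a two-sided ideal that is essential
as a right ideal. -/
def IsRightBounded : Prop :=
  ∀ I : Submodule Rᵐᵒᵖ R, IsEssentialRightIdeal I →
    ∃ A : TwoSidedIdeal R, IsEssentialRightIdeal (toRightIdeal A) ∧ toRightIdeal A ≤ I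

/-- `R` is right fully bounded: `R / p` is right bounded for every prime ideal `p`. -/
def IsRightFullyBounded : Prop :=
  ∀ p : TwoSidedIdeal R, IsPrimeIdeal p → IsRightBounded p.ringCon.Quotient

/-- The full set `X` of `m`-prime ideals of `R`: all primes `p` with `dim R / p = m`. -/
def fullSet (m : ℕ) : Set (TwoSidedIdeal R) :=
  {p | IsPrimeIdeal p ∧ HasKrullDim R (R ⧸ toRightIdeal p) m}

variable {R}

/-- `C(X)`: the intersection of the sets `c(p)`, `p ∈ X`. -/
def regularModuloAll (X : Set (TwoSidedIdeal R)) : Set R :=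
  ⋂ p ∈ X, regularModulo p

/-- The right `R`-module `M` is `V`-torsion: for every `x` in `M` there is `t` in `V` with
`x t = 0`. -/
def IsTorsionModule (V : Set R) (M : Type*) [AddCommGroup M] [Module Rᵐᵒᵖ M] : Prop :=
  ∀ x : M, ∃ t ∈ V, MulOpposite.op t • x = 0

/-- The family `w`: the right ideals `I` with `R / I` a `V`-torsion module. -/
def familyW (V : Set R) : Set (Submodule Rᵐᵒᵖ R) :=
  {I | IsTorsionModule V (R ⧸ I)}

/-- The family `k`: the right ideals that meet `V`. -/
def familyK (V : Set R) : Set (Submodule Rᵐᵒᵖ R) :=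
  {I | ((I : Set R) ∩ V).Nonempty}

variable (R) in
/-- The family `g`: the right ideals `I` with `dim R / I < m`. -/
def familyG (m : ℕ) : Set (Submodule Rᵐᵒᵖ R) :=
  {I | KrullDimLT R (R ⧸ I) m}

end RightFBN

/-!
For part (a), a right ideal `I` with `R / I` torsion meets `V`, because some `t ∈ V` kills the class
of `1`.

For part (b), let `I` contain an element `t` that is regular modulo every `m`-prime ideal, and
suppose that `dim R / I` is not `< m`. As `R` is right noetherian, `I` is contained in a right ideal
`J` that is maximal with `dim R / J` not `< m`; then `dim R / J = m`, and all proper factors of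
`R / J` have dimension `< m`. Let `p` be the associated prime of `R / J`. It is an `m`-prime, since
boundedness embeds a nonzero right ideal of `R / p` into `R / J`
(`exists_isPrime_of_ne_top`), and a prime ring has the same dimension as any of its nonzero right
ideals (`IsPrime.devLT_top`). If `p ⊆ J`, then `J` contains `p + t * R`, whereas
`dim R / (p + t * R) < m` because the factors of the chain `p + t ^ i * R` are all isomorphic
(`DevLT.sup_span_of_regular`). This is a contradiction.

So the point is that `p` annihilates all of `R / J` (`exists_isPrime_le_of_maximal`). The elements
annihilated by `p` form a nonzero submodule `L / J`, so `dim R / L < m`, and `L` contains a two-sided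
ideal `A` with `dim R / A < m` (`exists_isTwoSided_le_of_devLT`). Then `(p + J) / J` is a factor
of the bimodule `p / A * p`. The main step is
`devLT_of_mul_mem`, which needs the noetherian condition on both sides: the right dimension of a bimodule is bounded by the right dimension of the ring
that acts on its left. Hence `dim (p + J) / J < m`, which is possible only for `p ⊆ J`.

Goldie's theorem is avoided: all that is used is that a nonzero ideal of a prime noetherian ring
contains an element with zero right annihilator (`IsPrime.exists_regular`). All arguments take place
in the lattice of right ideals of `R`, a subquotient `Z / Y` of `R` being represented by the
interval `[Y, Z]`.
-/

namespace RightFBN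

/-! ### Deviation of intervals in a modular lattice -/

section Deviation

variable {P Q : Type*}

theorem DevLT.mono [PartialOrder P] {k : ℕ} {x y x' y' : P} (h : DevLT k x y) (hx : x ≤ x')
    (hxy : x' ≤ y') (hy : y' ≤ y) : DevLT k x' y' := by
  cases k with
  | zero =>
    have h : x = y := h
    exact le_antisymm hxy (hy.trans (h ▸ hx))
  | succ k => exact fun f hf hb => h f hf fun i => ⟨hx.trans (hb i).1, (hb i).2.trans hy⟩

theorem DevLT.refl [PartialOrder P] (k : ℕ) (x : P) : DevLT k x x := by
  induction k with
  | zero => rfl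
  | succ k ih =>
    intro f _ hb
    have hfx : ∀ i, f i = x := fun i => le_antisymm (hb i).2 (hb i).1
    exact ⟨0, fun i _ => by rw [hfx, hfx]; exact ih⟩

/-- A monotone map that is strictly monotone on an interval cannot decrease its deviation. -/
theorem DevLT.of_map [PartialOrder P] [PartialOrder Q] {e : P → Q} (he : Monotone e) {k : ℕ} :
    ∀ {x y : P}, (∀ a b, x ≤ a → a ≤ b → b ≤ y → e a = e b → a = b) → x ≤ y →
      DevLT k (e x) (e y) → DevLT k x y := by
  induction k with
  | zero => exact fun hinj hxy h => hinj _ _ le_rfl hxy le_rfl h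
  | succ k ih =>
    intro x y hinj hxy h f hf hb
    obtain ⟨N, hN⟩ := h (fun i => e (f i)) (fun i j hij => he (hf hij))
      fun i => ⟨he (hb i).1, he (hb i).2⟩
    exact ⟨N, fun i hi => ih
      (fun a b ha hab hb' => hinj a b ((hb _).1.trans ha) hab (hb'.trans (hb _).2))
      (hf (Nat.le_succ i)) (hN i hi)⟩

variable [Lattice P] [IsModularLattice P]

/-- Second isomorphism theorem for deviations. -/
theorem DevLT.inf_left {k : ℕ} {x y : P} (h : DevLT k x (x ⊔ y)) : DevLT k (x ⊓ y) y := by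
  refine DevLT.of_map (e := fun a => x ⊔ a) (fun a b hab => sup_le_sup_left hab x) ?_
    inf_le_right ?_
  · intro a b ha hab hb heq
    have key : ∀ c, x ⊓ y ≤ c → c ≤ y → (x ⊔ c) ⊓ y = c := fun c hc hcy => by
      rw [sup_comm, sup_inf_assoc_of_le x hcy, sup_eq_left.2 hc]
    rw [← key a ha (hab.trans hb), ← key b (ha.trans hab) hb]
    exact congrArg (· ⊓ y) heq
  · simpa using h

/-- Second isomorphism theorem for deviations. -/
theorem DevLT.sup_left {k : ℕ} {x y : P} (h : DevLT k (x ⊓ y) y) : DevLT k x (x ⊔ y) := by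
  refine DevLT.of_map (e := fun a => a ⊓ y) (fun a b hab => inf_le_inf_right y hab) ?_
    le_sup_left ?_
  · intro a b ha hab hb heq
    have key : ∀ c, x ≤ c → c ≤ x ⊔ y → x ⊔ c ⊓ y = c := fun c hc hcy => by
      rw [inf_comm, ← sup_inf_assoc_of_le y hc, inf_eq_right.2 hcy]
    rw [← key a ha (hab.trans hb), ← key b (ha.trans hab) hb]
    exact congrArg (x ⊔ ·) heq
  · simpa using h

theorem DevLT.trans {k : ℕ} : ∀ {x y z : P}, x ≤ y → y ≤ z → DevLT k x y → DevLT k y z →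
    DevLT k x z := by
  induction k with
  | zero => exact fun _ _ h₁ h₂ => Eq.trans (α := P) h₁ h₂
  | succ k ih =>
    intro x y z hxy hyz h₁ h₂ f hf hb
    obtain ⟨N₁, hN₁⟩ := h₁ (fun i => f i ⊓ y) (fun i j hij => inf_le_inf_right y (hf hij))
      fun i => ⟨le_inf (hb i).1 hxy, inf_le_right⟩
    obtain ⟨N₂, hN₂⟩ := h₂ (fun i => f i ⊔ y) (fun i j hij => sup_le_sup_right (hf hij) y)
      fun i => ⟨le_sup_right, sup_le (hb i).2 hyz⟩
    refine ⟨max N₁ N₂, fun i hi => ?_⟩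
    have hle : f (i + 1) ≤ f i := hf (Nat.le_succ i)
    have g₁ := hN₁ i ((le_max_left _ _).trans hi)
    have g₂ := hN₂ i ((le_max_right _ _).trans hi)
    -- the factor is an extension of a factor of the trace on `y` by a factor modulo `y`
    refine ih (y := f (i + 1) ⊔ f i ⊓ y) le_sup_left (sup_le hle inf_le_left) ?_ ?_
    · refine DevLT.sup_left ?_
      rwa [← inf_assoc, inf_eq_left.2 hle]
    · have hmod : (f (i + 1) ⊔ y) ⊓ f i = f (i + 1) ⊔ f i ⊓ y := by
        rw [sup_inf_assoc_of_le y hle, inf_comm]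
      rw [← hmod]
      refine DevLT.inf_left (g₂.mono le_rfl le_sup_left ?_)
      exact sup_le (sup_le_sup_right hle y) le_sup_left

theorem DevLT.inf_top [OrderTop P] {k : ℕ} {x y : P} (hx : DevLT k x ⊤) (hy : DevLT k y ⊤) :
    DevLT k (x ⊓ y) ⊤ :=
  DevLT.trans inf_le_right le_top (DevLT.inf_left (hx.mono le_rfl le_sup_left le_top)) hy

/-- If every essential element `c` of a noetherian interval `[x, y]` gives an interval `[c, y]` of
deviation `< k`, then `[x, y]` has deviation `< k + 1`: the members of a descending chain become
essential when joined with a common element `d` that is independent of almost all of them. -/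
theorem devLT_succ_of_essential [WellFoundedGT P] {k : ℕ} {x y : P} (hxy : x ≤ y)
    (h : ∀ c, x ≤ c → c ≤ y → (∀ e, x < e → e ≤ y → ¬ c ⊓ e ≤ x) → DevLT k c y) :
    DevLT (k + 1) x y := by
  intro f hf hb
  obtain ⟨d, ⟨⟨hxd, hdy, i, hi⟩, hmax⟩⟩ := exists_maximal_of_wellFoundedGT
    (fun d : P => x ≤ d ∧ d ≤ y ∧ ∃ i, d ⊓ f i ≤ x) ⟨x, le_rfl, hxy, 0, inf_le_left⟩
  refine ⟨i, fun j hij => ?_⟩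
  have hle : f (j + 1) ≤ f j := hf (Nat.le_succ j)
  have hdj : d ⊓ f j ≤ x := (inf_le_inf_left d (hf hij)).trans hi
  have hc : DevLT k (f (j + 1) ⊔ d) y := by
    refine h _ (hxd.trans le_sup_right) (sup_le (hb _).2 hdy) fun e hxe hey hce => ?_
    have hind : (d ⊔ e) ⊓ f (j + 1) ≤ x := by
      refine (le_inf ?_ inf_le_right).trans ((inf_le_inf_left d hle).trans hdj)
      refine (inf_le_inf_left (d ⊔ e) (le_sup_left : _ ≤ f (j + 1) ⊔ d)).trans ?_
      rw [sup_inf_assoc_of_le e le_sup_right, inf_comm]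
      exact sup_le le_rfl (hce.trans hxd)
    have hed : e ≤ d := le_sup_right.trans
      (hmax ⟨hxd.trans le_sup_left, sup_le hdy hey, j + 1, hind⟩ le_sup_left)
    exact hxe.not_ge ((le_inf (hed.trans le_sup_right) le_rfl).trans hce)
  have hmod : (f (j + 1) ⊔ d) ⊓ f j = f (j + 1) := by
    rw [sup_inf_assoc_of_le d hle, sup_eq_left]
    exact hdj.trans (hb _).1
  rw [← hmod]
  exact DevLT.inf_left
    (hc.mono le_rfl le_sup_left (sup_le (sup_le (hb _).2 hdy) (hb j).2))

end Deviation

/-! ### Right ideals and their residuals -/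

variable {R : Type*} [Ring R]

theorem mul_mem_of_mem (Y : Submodule Rᵐᵒᵖ R) {x : R} (hx : x ∈ Y) (r : R) : x * r ∈ Y :=
  Y.smul_mem (MulOpposite.op r) hx

theorem mem_sup_span {Y : Submodule Rᵐᵒᵖ R} {x z : R} :
    x ∈ Y ⊔ Submodule.span Rᵐᵒᵖ {z} ↔ ∃ y ∈ Y, ∃ r, y + z * r = x := by
  simp only [Submodule.mem_sup, Submodule.mem_span_singleton]
  constructor
  · rintro ⟨y, hy, _, ⟨r, rfl⟩, rfl⟩
    exact ⟨y, hy, r.unop, rfl⟩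
  · rintro ⟨y, hy, r, rfl⟩
    exact ⟨y, hy, _, ⟨MulOpposite.op r, rfl⟩, rfl⟩

theorem mem_sup_span_self (Y : Submodule Rᵐᵒᵖ R) (z : R) :
    z ∈ Y ⊔ Submodule.span Rᵐᵒᵖ {z} :=
  (le_sup_right : _ ≤ Y ⊔ Submodule.span Rᵐᵒᵖ {z}) (Submodule.mem_span_singleton_self z)

/-- The right ideal `{r | x * r ∈ Y}`, the annihilator of the class of `x` in `R / Y`. -/
def colon (x : R) (Y : Submodule Rᵐᵒᵖ R) : Submodule Rᵐᵒᵖ R where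
  carrier := {r | x * r ∈ Y}
  add_mem' := fun ha hb => by
    simpa only [Set.mem_ofPred_eq, mul_add] using Y.add_mem ha hb
  zero_mem' := by simp
  smul_mem' := fun c r hr => by
    simpa only [Set.mem_ofPred_eq, MulOpposite.smul_eq_mul_unop, mul_assoc] using
      mul_mem_of_mem Y hr c.unop

@[simp]
theorem mem_colon {x r : R} {Y : Submodule Rᵐᵒᵖ R} : r ∈ colon x Y ↔ x * r ∈ Y := Iff.rfl

theorem colon_mono (x : R) : Monotone (colon x) := fun _ _ h _ hr => h hr

/-- The class of `z` in `R / J` generates a module isomorphic to `R / colon z J`. -/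
theorem devLT_sup_span {k : ℕ} {J : Submodule Rᵐᵒᵖ R} {z : R} (h : DevLT k (colon z J) ⊤) :
    DevLT k J (J ⊔ Submodule.span Rᵐᵒᵖ {z}) := by
  refine DevLT.of_map (colon_mono z) ?_ le_sup_left
    (h.mono le_rfl (colon_mono z le_sup_left) le_top)
  intro a b ha hab hb heq
  refine le_antisymm hab fun x hx => ?_
  obtain ⟨y, hy, r, rfl⟩ := mem_sup_span.1 (hb hx)
  have hr : r ∈ colon z b := by
    simpa using b.sub_mem hx (hab (ha hy))
  rw [← heq] at hr
  exact a.add_mem (ha hy) hr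

/-- The class of `z` in `R / J` generates a module isomorphic to `R / colon z J`. -/
theorem DevLT.colon {k : ℕ} {J Z : Submodule Rᵐᵒᵖ R} (h : DevLT k J Z) (hJZ : J ≤ Z) {z : R}
    (hz : z ∈ Z) : DevLT k (colon z J) ⊤ := by
  let e : Submodule Rᵐᵒᵖ R → Submodule Rᵐᵒᵖ R :=
    fun Y => J ⊔ Y.map (DistribSMul.toLinearMap Rᵐᵒᵖ R z)
  have he : Monotone e := fun a b hab => sup_le_sup_left (Submodule.map_mono hab) J
  have mem_e : ∀ Y x, x ∈ e Y ↔ ∃ j ∈ J, ∃ r ∈ Y, j + z * r = x := fun Y x => by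
    simp [e, Submodule.mem_sup, Submodule.mem_map]
  refine DevLT.of_map he ?_ le_top (h.mono le_sup_left (he le_top) ?_)
  · intro a b ha hab _ heq
    refine le_antisymm hab fun r hr => ?_
    have hzr : z * r ∈ e a := by
      rw [heq, mem_e]
      exact ⟨0, J.zero_mem, r, hr, zero_add _⟩
    obtain ⟨j, hj, s, hs, hjs⟩ := (mem_e _ _).1 hzr
    have hrs : r - s ∈ RightFBN.colon z J := by
      rw [mem_colon, mul_sub, ← hjs, add_sub_cancel_right]
      exact hj
    simpa using a.add_mem (ha hrs) hs
  · intro x hx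
    obtain ⟨j, hj, s, -, rfl⟩ := (mem_e _ _).1 hx
    exact Z.add_mem (hJZ hj) (mul_mem_of_mem Z hz s)

/-- In a right noetherian ring `Z / J` has dimension `< k` as soon as all its cyclic submodules
have. -/
theorem devLT_of_forall_colon [IsNoetherian Rᵐᵒᵖ R] {k : ℕ} {J Z : Submodule Rᵐᵒᵖ R} (hJZ : J ≤ Z)
    (h : ∀ z ∈ Z, DevLT k (colon z J) ⊤) : DevLT k J Z := by
  obtain ⟨Y, ⟨⟨hJY, hYZ, hY⟩, hmax⟩⟩ := exists_maximal_of_wellFoundedGT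
    (fun Y : Submodule Rᵐᵒᵖ R => J ≤ Y ∧ Y ≤ Z ∧ DevLT k J Y) ⟨J, le_rfl, hJZ, DevLT.refl k J⟩
  rcases hYZ.eq_or_lt with rfl | hlt
  · exact hY
  · obtain ⟨z, hz, hzY⟩ := SetLike.exists_of_lt hlt
    have hle : Y ⊔ Submodule.span Rᵐᵒᵖ {z} ≤ Z := sup_le hYZ (by simpa using hz)
    refine absurd (hmax ⟨hJY.trans le_sup_left, hle, ?_⟩ le_sup_left (mem_sup_span_self Y z)) hzY
    exact hY.trans hJY le_sup_left
      (devLT_sup_span ((h z hz).mono (colon_mono z hJY) le_top le_rfl))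

/-- A right ideal that is closed under multiplication from the left. -/
def IsTwoSided (A : Submodule Rᵐᵒᵖ R) : Prop := ∀ r x, x ∈ A → r * x ∈ A

/-- A two-sided ideal, given as a right ideal, that is prime. -/
structure IsPrime (p : Submodule Rᵐᵒᵖ R) : Prop where
  isTwoSided : IsTwoSided p
  ne_top : p ≠ ⊤
  mem_or_mem : ∀ a b, (∀ r, a * r * b ∈ p) → a ∈ p ∨ b ∈ p

/-- The largest two-sided ideal contained in the right ideal `Y`. -/
def core (Y : Submodule Rᵐᵒᵖ R) : Submodule Rᵐᵒᵖ R where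
  carrier := {x | ∀ s, s * x ∈ Y}
  add_mem' := fun ha hb s => by
    rw [mul_add]
    exact Y.add_mem (ha s) (hb s)
  zero_mem' := by simp
  smul_mem' := fun c x hx s => by
    simpa only [MulOpposite.smul_eq_mul_unop, mul_assoc] using mul_mem_of_mem Y (hx s) c.unop

theorem core_isTwoSided (Y : Submodule Rᵐᵒᵖ R) : IsTwoSided (core Y) := fun r x hx s => by
  rw [← mul_assoc]
  exact hx _

theorem core_le (Y : Submodule Rᵐᵒᵖ R) : core Y ≤ Y := fun x hx => by simpa using hx 1

theorem IsTwoSided.le_core {A Y : Submodule Rᵐᵒᵖ R} (hA : IsTwoSided A) (h : A ≤ Y) :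
    A ≤ core Y := fun x hx s => h (hA s x hx)

theorem IsTwoSided.inf {A B : Submodule Rᵐᵒᵖ R} (hA : IsTwoSided A) (hB : IsTwoSided B) :
    IsTwoSided (A ⊓ B) := fun r x hx => ⟨hA r x hx.1, hB r x hx.2⟩

/-- The right ideal of all `a` with `S * a ⊆ Y`; for two-sided ideals `Y ⊆ S` this is the right
annihilator of the bimodule `S / Y`. -/
def rightAnn (S Y : Submodule Rᵐᵒᵖ R) : Submodule Rᵐᵒᵖ R :=
  ⨅ x ∈ S, colon x Y

theorem mem_rightAnn {S Y : Submodule Rᵐᵒᵖ R} {a : R} :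
    a ∈ rightAnn S Y ↔ ∀ x ∈ S, x * a ∈ Y := by
  simp [rightAnn]

theorem rightAnn_isTwoSided (S Y : Submodule Rᵐᵒᵖ R) : IsTwoSided (rightAnn S Y) :=
  fun r a ha => mem_rightAnn.2 fun x hx => by
    rw [← mul_assoc]
    exact mem_rightAnn.1 ha _ (mul_mem_of_mem S hx r)

/-- All `a` with `a * S ⊆ Y`; for two-sided ideals `Y ⊆ S` this is the left annihilator of the
bimodule `S / Y`. It is a right ideal because `S` is two-sided. -/
def leftAnn (S Y : Submodule Rᵐᵒᵖ R) (hS : IsTwoSided S) : Submodule Rᵐᵒᵖ R where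
  carrier := {a | ∀ x ∈ S, a * x ∈ Y}
  add_mem' := fun ha hb x hx => by
    rw [add_mul]
    exact Y.add_mem (ha x hx) (hb x hx)
  zero_mem' := by simp
  smul_mem' := fun c a ha x hx => by
    simpa only [MulOpposite.smul_eq_mul_unop, mul_assoc] using ha _ (hS c.unop x hx)

theorem leftAnn_isTwoSided {S Y : Submodule Rᵐᵒᵖ R} (hS : IsTwoSided S) (hY : IsTwoSided Y) :
    IsTwoSided (leftAnn S Y hS) := fun r a ha x hx => by
  rw [mul_assoc]
  exact hY r _ (ha x hx)

/-! ### Elements regular modulo a prime ideal -/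

theorem isNoetherian_of_isTwoSidedNoetherian (h : IsTwoSidedNoetherian R) :
    IsNoetherian Rᵐᵒᵖ R := by
  have : IsNoetherian Rᵐᵒᵖ Rᵐᵒᵖ := h.2
  let e : Rᵐᵒᵖ ≃ₗ[Rᵐᵒᵖ] R :=
    { MulOpposite.opAddEquiv.symm with map_smul' := fun _ _ => rfl }
  exact isNoetherian_of_linearEquiv e

theorem IsPrime.one_notMem {p : Submodule Rᵐᵒᵖ R} (hp : IsPrime p) : (1 : R) ∉ p := fun h =>
  hp.ne_top (eq_top_iff.2 fun r _ => by simpa using mul_mem_of_mem p h r)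

/-- If `c` is not a left zero divisor modulo the two-sided ideal `J`, then the factors of the chain
`J + c ^ i * R` are all isomorphic to `R / (J + c * R)`, whose dimension is therefore smaller than
that of `R / J`. -/
theorem DevLT.sup_span_of_regular {k : ℕ} {J : Submodule Rᵐᵒᵖ R} (h : DevLT (k + 1) J ⊤) {c : R}
    (hc : ∀ r, c * r ∈ J → r ∈ J) : DevLT k (J ⊔ Submodule.span Rᵐᵒᵖ {c}) ⊤ := by
  obtain ⟨N, hN⟩ := h (fun i => J ⊔ Submodule.span Rᵐᵒᵖ {c ^ i})
    (antitone_nat_of_succ_le fun i => sup_le le_sup_left <| by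
      rw [Submodule.span_le, Set.singleton_subset_iff, pow_succ]
      exact mul_mem_of_mem _ (mem_sup_span_self J _) c)
    fun i => ⟨le_sup_left, le_top⟩
  have hpow : ∀ n r, c ^ n * r ∈ J → r ∈ J := by
    intro n
    induction n with
    | zero => simp
    | succ n ih =>
      intro r hr
      rw [pow_succ, mul_assoc] at hr
      exact hc r (ih _ hr)
  have hle : J ⊔ Submodule.span Rᵐᵒᵖ {c ^ (N + 1)} ≤ J ⊔ Submodule.span Rᵐᵒᵖ {c ^ N} :=
    sup_le le_sup_left <| by
      rw [Submodule.span_le, Set.singleton_subset_iff, pow_succ]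
      exact mul_mem_of_mem _ (mem_sup_span_self J _) c
  refine ((hN N le_rfl).colon hle (mem_sup_span_self J _)).mono (fun r hr => ?_) le_top le_rfl
  obtain ⟨j, hj, s, hs⟩ := mem_sup_span.1 (mem_colon.1 hr)
  refine mem_sup_span.2 ⟨r - c * s, hpow N _ ?_, s, by simp⟩
  have : c ^ N * (r - c * s) = j := by
    rw [mul_sub, ← mul_assoc, ← pow_succ, ← hs, add_sub_cancel_right]
  rwa [this]

section Regular

variable [IsNoetherian Rᵐᵒᵖ R]

/-- A right ideal strictly containing a prime ideal `p` is not nil modulo `p`. This is Utumi's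
argument: if it were, an element `s * h` with maximal annihilator modulo `p` among the left
multiples of an `h` would satisfy `s * h * R * s * h ⊆ p`. -/
theorem IsPrime.exists_forall_pow_notMem {p H : Submodule Rᵐᵒᵖ R} (hp : IsPrime p) (h : p < H) :
    ∃ a ∈ H, ∀ n : ℕ, a ^ n ∉ p := by
  by_contra! hnil
  obtain ⟨h₀, hH, hh₀⟩ := SetLike.exists_of_lt h
  obtain ⟨C, ⟨⟨s, hs, rfl⟩, hmax⟩⟩ := exists_maximal_of_wellFoundedGT
    (fun C : Submodule Rᵐᵒᵖ R => ∃ s, s * h₀ ∉ p ∧ colon (s * h₀) p = C)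
    ⟨_, 1, by simpa using hh₀, rfl⟩
  refine hs ((hp.mem_or_mem (s * h₀) (s * h₀) fun x => ?_).elim id id)
  by_cases hy : x * (s * h₀) ∈ p
  · rw [mul_assoc]
    exact hp.isTwoSided _ _ hy
  -- `y = x * s * h₀` is nilpotent modulo `p`, since `h₀ * x * s` is
  obtain ⟨n, hn⟩ := hnil (h₀ * (x * s)) (mul_mem_of_mem H hH _)
  have hshift : ∀ n : ℕ, (x * (s * h₀)) ^ (n + 1) = x * s * (h₀ * (x * s)) ^ n * h₀ := by
    intro n
    induction n with
    | zero => simp [mul_assoc]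
    | succ n ih =>
      rw [pow_succ, ih, pow_succ]
      simp only [mul_assoc]
  have hex : ∃ n : ℕ, (x * (s * h₀)) ^ n ∈ p := ⟨n + 1, by
    rw [hshift]
    exact mul_mem_of_mem p (hp.isTwoSided _ _ hn) _⟩
  classical
  have hfind := Nat.find_spec hex
  have hmin := fun m => Nat.find_min hex (m := m)
  generalize Nat.find hex = N at hfind hmin
  match N, hfind, hmin with
  | 0, hfind, _ => exact absurd (by simpa using hfind) hp.one_notMem
  | 1, hfind, _ => exact absurd (by simpa using hfind) hy
  | N + 2, hfind, hmin =>
    have hnot : (x * (s * h₀)) ^ N * x * s * h₀ ∉ p := by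
      have := hmin (N + 1) (by omega)
      rwa [pow_succ, ← mul_assoc, ← mul_assoc] at this
    have hle : colon (s * h₀) p ≤ colon ((x * (s * h₀)) ^ N * x * s * h₀) p := fun r hr => by
      have := hp.isTwoSided ((x * (s * h₀)) ^ N * x) _ (mem_colon.1 hr)
      simpa only [mem_colon, mul_assoc] using this
    have hmem : x * (s * h₀) ∈ colon (s * h₀) p := by
      refine hmax ⟨_, hnot, rfl⟩ hle ?_
      rw [mem_colon]
      have : (x * (s * h₀)) ^ N * x * s * h₀ * (x * (s * h₀)) = (x * (s * h₀)) ^ (N + 2) := by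
        rw [pow_succ, pow_succ]
        simp only [mul_assoc]
      rwa [this]
    rw [mul_assoc]
    exact hmem

/-- A right ideal strictly containing a prime ideal `p` contains an element `b ∉ p` whose right
annihilator modulo `p` meets `b * R` trivially. -/
theorem IsPrime.exists_mul_self_regular {p H : Submodule Rᵐᵒᵖ R} (hp : IsPrime p) (h : p < H) :
    ∃ b ∈ H, b ∉ p ∧ ∀ s, b * (b * s) ∈ p → b * s ∈ p := by
  obtain ⟨a, haH, ha⟩ := hp.exists_forall_pow_notMem h
  obtain ⟨N, hN⟩ := WellFoundedGT.monotone_chain_condition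
    (⟨fun n => colon (a ^ n) p, monotone_nat_of_le_succ fun n r hr => by
      rw [mem_colon, pow_succ', mul_assoc]
      exact hp.isTwoSided _ _ hr⟩ : ℕ →o Submodule Rᵐᵒᵖ R)
  refine ⟨a ^ (N + 1), ?_, ha _, fun s hs => ?_⟩
  · rw [pow_succ']
    exact mul_mem_of_mem H haH _
  · have h₁ : colon (a ^ N) p = colon (a ^ (N + 1)) p := hN _ (by omega)
    have h₂ : colon (a ^ N) p = colon (a ^ (N + 1 + (N + 1))) p := hN _ (by omega)
    rw [← mem_colon, ← h₁, h₂, mem_colon, pow_add, mul_assoc]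
    exact hs

/-- A two-sided ideal strictly containing a prime ideal `p` contains an element that is not a left
zero divisor modulo `p`. It lies in a right ideal `G` that is maximal among those containing an
element with trivial right annihilator in `G`. -/
theorem IsPrime.exists_regular {p A : Submodule Rᵐᵒᵖ R} (hp : IsPrime p) (hA : IsTwoSided A)
    (h : p < A) : ∃ c ∈ A, ∀ r, c * r ∈ p → r ∈ p := by
  obtain ⟨G, ⟨⟨hpG, hGA, c, hcG, hc⟩, hmax⟩⟩ := exists_maximal_of_wellFoundedGT
    (fun G : Submodule Rᵐᵒᵖ R => p ≤ G ∧ G ≤ A ∧ ∃ c ∈ G, ∀ x ∈ G, c * x ∈ p → x ∈ p)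
    ⟨p, le_rfl, h.le, 0, p.zero_mem, fun x hx _ => hx⟩
  refine ⟨c, hGA hcG, fun r hr => ?_⟩
  by_contra hrp
  obtain ⟨a, haA, hap⟩ := SetLike.exists_of_lt h
  have hlt : p < colon c p ⊓ A := by
    refine lt_of_le_not_ge (le_inf (fun x hx => hp.isTwoSided c x hx) h.le) fun hle => ?_
    refine (hp.mem_or_mem r a fun s => hle ⟨?_, hA _ _ haA⟩).elim hrp hap
    have := mul_mem_of_mem p hr (s * a)
    rwa [mul_assoc, ← mul_assoc r] at this
  obtain ⟨b, ⟨hcb, hbA⟩, hbp, hb⟩ := hp.exists_mul_self_regular hlt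
  have hcb : c * b ∈ p := hcb
  -- `c + b` has trivial right annihilator in `G + b * R`, which contradicts maximality
  have hbG : b ∈ G := by
    refine hmax (y := G ⊔ Submodule.span Rᵐᵒᵖ {b}) ⟨hpG.trans le_sup_left,
      sup_le hGA (by simpa using hbA), c + b, ?_, ?_⟩ le_sup_left (mem_sup_span_self G b)
    · exact add_mem ((le_sup_left : G ≤ _) hcG) (mem_sup_span_self G b)
    intro x hx hcx
    obtain ⟨g, hg, s, rfl⟩ := mem_sup_span.1 hx
    have hcbs : c * (b * s) ∈ p := by
      rw [← mul_assoc]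
      exact mul_mem_of_mem p hcb s
    have h₁ : c * (g + b * s) ∈ p := by
      refine hc _ (mul_mem_of_mem G hcG _) ?_
      have hsum := p.sub_mem (hp.isTwoSided c _ hcx) (mul_mem_of_mem p hcb (g + b * s))
      have heq : c * ((c + b) * (g + b * s)) - c * b * (g + b * s) = c * (c * (g + b * s)) := by
        noncomm_ring
      rwa [heq] at hsum
    have hgp : g ∈ p := by
      refine hc g hg ?_
      have := p.sub_mem h₁ hcbs
      rwa [mul_add, add_sub_cancel_right] at this
    refine p.add_mem hgp (hb s ?_)
    have := p.sub_mem (p.sub_mem hcx h₁) (hp.isTwoSided b g hgp)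
    have heq : (c + b) * (g + b * s) - c * (g + b * s) - b * g = b * (b * s) := by
      noncomm_ring
    rwa [heq] at this
  exact hbp (hc b hbG hcb)

/-- Factoring a prime ring by a nonzero ideal lowers its dimension. -/
theorem IsPrime.devLT_of_lt {k : ℕ} {p A : Submodule Rᵐᵒᵖ R} (hp : IsPrime p) (hA : IsTwoSided A)
    (h : p < A) (hdim : DevLT (k + 1) p ⊤) : DevLT k A ⊤ := by
  obtain ⟨c, hcA, hc⟩ := hp.exists_regular hA h
  exact (hdim.sup_span_of_regular hc).mono (sup_le h.le (by simpa using hcA)) le_top le_rfl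

end Regular

/-! ### Bounded prime factors -/

/-- Every right ideal that contains `p` and is essential modulo `p` contains a two-sided ideal
strictly larger than `p`. -/
def IsBoundedModulo (p : Submodule Rᵐᵒᵖ R) : Prop :=
  ∀ E, p ≤ E → (∀ J, p < J → ¬ E ⊓ J ≤ p) → ∃ A, IsTwoSided A ∧ p < A ∧ A ≤ E

theorem IsTwoSided.exists_twoSidedIdeal {p : Submodule Rᵐᵒᵖ R} (hp : IsTwoSided p) :
    ∃ q : TwoSidedIdeal R, toRightIdeal q = p :=
  ⟨TwoSidedIdeal.mk' p p.zero_mem p.add_mem p.neg_mem (fun h => hp _ _ h)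
    (fun h => mul_mem_of_mem p h _), by ext x; simp [toRightIdeal]⟩

theorem mem_toRightIdeal {q : TwoSidedIdeal R} {x : R} : x ∈ toRightIdeal q ↔ x ∈ q := Iff.rfl

theorem toRightIdeal_isTwoSided (q : TwoSidedIdeal R) : IsTwoSided (toRightIdeal q) :=
  fun r _ hx => q.mul_mem_left r _ hx

theorem toRightIdeal_eq_top {q : TwoSidedIdeal R} : toRightIdeal q = ⊤ ↔ q = ⊤ := by
  rw [← TwoSidedIdeal.one_mem_iff, eq_top_iff]
  exact ⟨fun h => h (Submodule.mem_top (x := 1)),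
    fun h r _ => by simpa using mul_mem_of_mem (toRightIdeal q) h r⟩

theorem isPrimeIdeal_iff {q : TwoSidedIdeal R} : IsPrimeIdeal q ↔ IsPrime (toRightIdeal q) :=
  ⟨fun h => ⟨toRightIdeal_isTwoSided q, fun h' => h.1 (toRightIdeal_eq_top.1 h'), h.2⟩,
    fun h => ⟨fun h' => h.ne_top (toRightIdeal_eq_top.2 h'), h.mem_or_mem⟩⟩

theorem mk_eq_zero_iff {q : TwoSidedIdeal R} {x : R} : q.ringCon.mk' x = 0 ↔ x ∈ q := by
  rw [TwoSidedIdeal.mem_iff]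
  exact RingCon.eq _

theorem IsRightFullyBounded.isBoundedModulo (hR : IsRightFullyBounded R)
    {p : Submodule Rᵐᵒᵖ R} (hp : IsPrime p) : IsBoundedModulo p := by
  obtain ⟨q, rfl⟩ := hp.isTwoSided.exists_twoSidedIdeal
  intro E hqE hess
  let π := q.ringCon.mk'
  have hπ : Function.Surjective π := q.ringCon.mk'_surjective
  -- the image of `E` in `R / q` is essential
  let E' : Submodule (q.ringCon.Quotient)ᵐᵒᵖ q.ringCon.Quotient :=
    { carrier := π '' E
      add_mem' := by
        rintro _ _ ⟨a, ha, rfl⟩ ⟨b, hb, rfl⟩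
        exact ⟨a + b, E.add_mem ha hb, map_add π a b⟩
      zero_mem' := ⟨0, E.zero_mem, map_zero π⟩
      smul_mem' := by
        rintro c _ ⟨a, ha, rfl⟩
        obtain ⟨r, hr⟩ := hπ c.unop
        exact ⟨a * r, mul_mem_of_mem E ha r, by
          rw [map_mul, hr, MulOpposite.smul_eq_mul_unop]⟩ }
  have hE' : IsEssentialRightIdeal E' := by
    intro J' hJ' hbot
    let J : Submodule Rᵐᵒᵖ R :=
      { carrier := π ⁻¹' J'
        add_mem' := fun {a b} ha hb => by
          change π (a + b) ∈ J'
          rw [map_add]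
          exact J'.add_mem ha hb
        zero_mem' := by
          change π 0 ∈ J'
          rw [map_zero]
          exact J'.zero_mem
        smul_mem' := fun c x hx => by
          change π (x * c.unop) ∈ J'
          rw [map_mul]
          exact mul_mem_of_mem J' hx _ }
    have hqJ : toRightIdeal q ≤ J := fun x hx => by
      change π x ∈ J'
      rw [mk_eq_zero_iff.2 hx]
      exact J'.zero_mem
    refine hess J (lt_of_le_not_ge hqJ fun hle => hJ' ?_) fun x hx => ?_
    · rw [eq_bot_iff]
      intro y hy
      obtain ⟨x, rfl⟩ := hπ y
      exact mk_eq_zero_iff.2 (hle hy)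
    · have : π x ∈ E' ⊓ J' := ⟨⟨x, hx.1, rfl⟩, hx.2⟩
      rw [hbot] at this
      exact mk_eq_zero_iff.1 this
  obtain ⟨A', hA', hle⟩ := hR q (isPrimeIdeal_iff.2 hp) E' hE'
  refine ⟨toRightIdeal (A'.comap π), toRightIdeal_isTwoSided _, lt_of_le_not_ge ?_ ?_, ?_⟩
  · intro x hx
    rw [mem_toRightIdeal, TwoSidedIdeal.mem_comap, mk_eq_zero_iff.2 hx]
    exact A'.zero_mem
  · intro hAq
    have htop : (⊤ : Submodule (q.ringCon.Quotient)ᵐᵒᵖ q.ringCon.Quotient) ≠ ⊥ := fun h => by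
      have h1 : π 1 ∈ (⊤ : Submodule (q.ringCon.Quotient)ᵐᵒᵖ q.ringCon.Quotient) :=
        Submodule.mem_top
      rw [h] at h1
      exact hp.one_notMem (mk_eq_zero_iff.1 h1)
    refine hA' ⊤ htop (eq_bot_iff.2 fun y hy => ?_)
    obtain ⟨x, rfl⟩ := hπ y
    exact mk_eq_zero_iff.2 (hAq ((TwoSidedIdeal.mem_comap π).2 hy.1))
  · intro x hx
    obtain ⟨e, he, hex⟩ := hle ((TwoSidedIdeal.mem_comap π).1 hx)
    have : x - e ∈ q := by
      rw [← mk_eq_zero_iff, map_sub, sub_eq_zero]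
      exact hex.symm
    simpa using E.add_mem (hqE this) he

/-- The submodules of `R / J` are the right ideals between `J` and `R`. -/
theorem krullDimLT_quotient_iff {J : Submodule Rᵐᵒᵖ R} {k : ℕ} :
    KrullDimLT R (R ⧸ J) k ↔ DevLT k J ⊤ := by
  have h : J.mkQ.ker = J := J.ker_mkQ
  constructor
  · intro hk
    refine DevLT.of_map (e := Submodule.map J.mkQ) (fun a b hab => Submodule.map_mono hab) ?_
      le_top (hk.mono bot_le (Submodule.map_mono le_top) le_top)
    intro a b ha hab _ heq
    have := congrArg (Submodule.comap J.mkQ) heq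
    rwa [Submodule.comap_map_eq, Submodule.comap_map_eq, h, sup_eq_left.2 ha,
      sup_eq_left.2 (ha.trans hab)] at this
  · intro hk
    refine DevLT.of_map (e := Submodule.comap J.mkQ) (fun a b hab => Submodule.comap_mono hab) ?_
      bot_le (hk.mono ?_ (Submodule.comap_mono bot_le) le_top)
    · intro a b _ _ _ heq
      exact Submodule.comap_injective_of_surjective J.mkQ_surjective heq
    · exact h.ge

/-! ### Associated primes and annihilators -/

/-- A nonzero right ideal of a prime ring has the same dimension as the ring: the elements of
`R / p` that generate a right ideal of dimension `< k` form a two-sided ideal, and finitely many of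
them generate it as a left ideal. If it is nonzero, these have no common right annihilator. -/
theorem IsPrime.devLT_top [IsNoetherianRing R] {k : ℕ} {p U : Submodule Rᵐᵒᵖ R} (hp : IsPrime p)
    (hpU : p < U) (hU : DevLT k p U) : DevLT k p ⊤ := by
  -- the left ideal of all `w` with `dim (w * R + p) / p < k`
  let W : Ideal R :=
    { carrier := {w | DevLT k (colon w p) ⊤}
      add_mem' := fun {a b} ha hb => (DevLT.inf_top ha hb).mono
        (fun r hr => by simpa [add_mul] using p.add_mem hr.1 hr.2) le_top le_rfl
      zero_mem' := by
        have : colon (0 : R) p = ⊤ := eq_top_iff.2 fun r _ => by simp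
        simpa only [Set.mem_ofPred_eq, this] using DevLT.refl k _
      smul_mem' := fun r w hw => DevLT.mono hw
        (fun s hs => by simpa [mul_assoc] using hp.isTwoSided r _ hs) le_top le_rfl }
  have hWU : ∀ u ∈ U, u ∈ W := fun u hu => hU.colon hpU.le hu
  have hWmul : ∀ w ∈ W, ∀ r, w * r ∈ W := fun w hw r => by
    have := DevLT.colon (z := r) hw le_top Submodule.mem_top
    refine DevLT.mono this (fun s hs => ?_) le_top le_rfl
    simpa [mul_assoc] using hs
  obtain ⟨u, huU, hup⟩ := SetLike.exists_of_lt hpU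
  obtain ⟨S, hS⟩ := IsNoetherian.noetherian W
  have hfin : ∀ T : Finset R, (∀ w ∈ T, w ∈ W) → DevLT k (T.inf fun w => colon w p) ⊤ := by
    classical
    intro T
    induction T using Finset.induction_on with
    | empty => exact fun _ => DevLT.refl k _
    | insert w T _ ih =>
      intro hT
      rw [Finset.inf_insert]
      exact DevLT.inf_top (hT w (by simp)) (ih fun v hv => hT v (by simp [hv]))
  refine (hfin S fun w hw => hS ▸ Submodule.subset_span hw).mono (fun r hr => ?_) le_top le_rfl
  have hr : ∀ w ∈ S, w * r ∈ p := fun w hw => (Finset.inf_le (f := fun w => colon w p) hw) hr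
  have hWr : ∀ w ∈ W, w * r ∈ p := by
    intro w hw
    rw [← hS] at hw
    induction hw using Submodule.span_induction with
    | mem x hx => exact hr x hx
    | zero => simp
    | add x y _ _ hx hy =>
      rw [add_mul]
      exact p.add_mem hx hy
    | smul a x _ hx =>
      rw [smul_mul_assoc]
      exact hp.isTwoSided a _ hx
  exact (hp.mem_or_mem u r fun s => hWr _ (hWmul u (hWU u huU) s)).resolve_left hup

section Annihilator

variable [IsNoetherian Rᵐᵒᵖ R]

/-- Over a right fully bounded ring every nonzero module `R / J` has an associated prime `p`, the
annihilator of the cyclic module generated by the class of some `x`, such that `dim R / p` does not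
exceed the dimension of that cyclic module: by boundedness it contains a copy of a nonzero right
ideal of `R / p`. -/
theorem exists_isPrime_of_ne_top [IsNoetherianRing R]
    (hR : ∀ p : Submodule Rᵐᵒᵖ R, IsPrime p → IsBoundedModulo p) {J : Submodule Rᵐᵒᵖ R}
    (hJ : J ≠ ⊤) : ∃ x, x ∉ J ∧ ∃ p, IsPrime p ∧ p ≤ colon x J ∧
      ∀ k, DevLT k J (J ⊔ Submodule.span Rᵐᵒᵖ {x}) → DevLT k p ⊤ := by
  obtain ⟨x₀, -, hx₀⟩ := SetLike.exists_of_lt hJ.lt_top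
  obtain ⟨p, ⟨⟨x, hxJ, rfl⟩, hmax⟩⟩ := exists_maximal_of_wellFoundedGT
    (fun p : Submodule Rᵐᵒᵖ R => ∃ x, x ∉ J ∧ core (colon x J) = p) ⟨_, x₀, hx₀, rfl⟩
  have hprime : IsPrime (core (colon x J)) := by
    refine ⟨core_isTwoSided _, fun h => hxJ ?_, fun a b hab => ?_⟩
    · have : (1 : R) ∈ colon x J := core_le _ (h ▸ Submodule.mem_top)
      simpa using this
    by_contra! hnot
    have ha : ∃ r, x * (r * a) ∉ J := by
      by_contra! ha
      exact hnot.1 ha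
    obtain ⟨r, hr⟩ := ha
    refine hnot.2 (hmax ⟨x * (r * a), hr, rfl⟩ (fun c hc s => ?_) fun s => ?_)
    · have := hc (r * a * s)
      simpa only [mem_colon, mul_assoc] using this
    · have := hab s r
      simpa only [mem_colon, mul_assoc] using this
  refine ⟨x, hxJ, core (colon x J), hprime, core_le _, fun k hk => ?_⟩
  -- by boundedness and maximality, `colon x J` is not essential modulo `p`
  have hness : ∃ U, core (colon x J) < U ∧ colon x J ⊓ U ≤ core (colon x J) := by
    by_contra! hess
    obtain ⟨A, hA, hlt, hle⟩ := hR _ hprime (colon x J) (core_le _) hess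
    exact hlt.not_ge (hA.le_core hle)
  obtain ⟨U, hU, hUle⟩ := hness
  have hE : DevLT k (colon x J) ⊤ := hk.colon le_sup_left (mem_sup_span_self J x)
  refine hprime.devLT_top hU ?_
  exact (DevLT.inf_left (hE.mono le_rfl le_sup_left le_top)).mono hUle hU.le le_rfl

/-- If `dim R / J < k`, then already the ring `R / A` has dimension `< k` for some two-sided ideal
`A ⊆ J`. -/
theorem exists_isTwoSided_le_of_devLT [IsNoetherianRing R]
    (hR : ∀ p : Submodule Rᵐᵒᵖ R, IsPrime p → IsBoundedModulo p) {k : ℕ}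
    {J : Submodule Rᵐᵒᵖ R} (hJ : DevLT k J ⊤) :
    ∃ A, IsTwoSided A ∧ A ≤ J ∧ DevLT k A ⊤ := by
  obtain ⟨F, ⟨⟨hJF, A, hA, hFA, hdim⟩, hmax⟩⟩ := exists_maximal_of_wellFoundedGT
    (fun F : Submodule Rᵐᵒᵖ R => J ≤ F ∧ ∃ A : Submodule Rᵐᵒᵖ R, IsTwoSided A ∧
      (∀ f ∈ F, A ≤ colon f J) ∧ DevLT k A ⊤)
    ⟨J, le_rfl, ⊤, fun _ _ _ => trivial, fun f hf r _ => mul_mem_of_mem J hf r, DevLT.refl k _⟩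
  by_cases hF : F = ⊤
  · exact ⟨A, hA, fun a ha => by simpa using hFA 1 (hF ▸ Submodule.mem_top) ha, hdim⟩
  exfalso
  obtain ⟨x, hx, p, hp, hxp, hpdim⟩ := exists_isPrime_of_ne_top hR hF
  have hpk : DevLT k p ⊤ := hpdim k (hJ.mono hJF le_sup_left le_top)
  -- the ideal `p * A` annihilates `(F + x * R) / J`
  let B : Submodule Rᵐᵒᵖ R := Submodule.span Rᵐᵒᵖ {y | ∃ b ∈ p, ∃ a ∈ A, b * a = y}
  have hB : IsTwoSided B := by
    intro r y hy
    have hle : B ≤ colon r B := by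
      rw [Submodule.span_le]
      rintro _ ⟨b, hb, a, ha, rfl⟩
      exact Submodule.subset_span ⟨r * b, hp.isTwoSided r b hb, a, ha, mul_assoc _ _ _⟩
    exact hle hy
  have hBp : B ≤ p := by
    rw [Submodule.span_le]
    rintro _ ⟨b, hb, a, -, rfl⟩
    exact mul_mem_of_mem p hb a
  have hBdim : DevLT k B ⊤ := by
    refine DevLT.trans hBp le_top (devLT_of_forall_colon hBp fun z hz => ?_) hpk
    exact hdim.mono (fun a ha => Submodule.subset_span ⟨z, hz, a, ha, rfl⟩) le_top le_rfl
  refine hx (hmax ⟨hJF.trans le_sup_left, B, hB, fun f hf => ?_, hBdim⟩ le_sup_left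
    (mem_sup_span_self F x))
  rw [Submodule.span_le]
  rintro _ ⟨b, hb, a, ha, rfl⟩
  obtain ⟨g, hg, r, rfl⟩ := mem_sup_span.1 hf
  have hmem : (g + x * r) * b ∈ F := by
    rw [add_mul, mul_assoc]
    exact F.add_mem (mul_mem_of_mem F hg b) (hxp (hp.isTwoSided r b hb))
  have := hFA _ hmem ha
  rwa [mem_colon, mul_assoc] at this

end Annihilator

/-! ### The dimension of bimodules -/

/-- Let the bimodule `B / N` have the prime right annihilator `p`, with `R / p` right bounded. If the
trace of `C` is essential in `B / N` as a right module, then `B * I ⊆ C` for some ideal `I` strictly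
larger than `p`. -/
theorem exists_mul_mem_of_essential [IsNoetherian Rᵐᵒᵖ R] {p B C N : Submodule Rᵐᵒᵖ R}
    (hp : IsPrime p) (hbdd : IsBoundedModulo p) (hNC : N ≤ C) (hNB : N ≤ B)
    (hB : rightAnn B N = p) (hess : ∀ e, N < e → e ≤ B → ¬ C ⊓ e ≤ N) :
    ∃ I, IsTwoSided I ∧ p < I ∧ ∀ b ∈ B, I ≤ colon b C := by
  -- intersections of nonzero ideals of a prime ring are nonzero
  have hinf : ∀ I I' : Submodule Rᵐᵒᵖ R, IsTwoSided I' → p < I → p < I' → p < I ⊓ I' := by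
    intro I I' hI' hpI hpI'
    refine lt_of_le_not_ge (le_inf hpI.le hpI'.le) fun hle => ?_
    obtain ⟨a, ha, hap⟩ := SetLike.exists_of_lt hpI
    obtain ⟨b, hb, hbp⟩ := SetLike.exists_of_lt hpI'
    refine (hp.mem_or_mem a b fun r => hle ⟨?_, hI' _ _ hb⟩).elim hap hbp
    have := mul_mem_of_mem I ha (r * b)
    rwa [← mul_assoc] at this
  have hone : ∀ b ∈ B, ∃ I, IsTwoSided I ∧ p < I ∧ I ≤ colon b C := by
    intro b hb
    have hpb : p ≤ colon b N := fun r hr => mem_rightAnn.1 (hB ▸ hr) b hb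
    refine hbdd _ (hpb.trans (colon_mono b hNC)) fun J hpJ hle => ?_
    by_cases hbJ : J ≤ colon b N
    · exact hpJ.not_ge ((le_inf (hbJ.trans (colon_mono b hNC)) le_rfl).trans hle)
    obtain ⟨r₀, hr₀, hbr₀⟩ := SetLike.not_le_iff_exists.1 hbJ
    -- `C` meets the right ideal `N + b * J` outside `N`
    have hlt : N < N ⊔ J.map (DistribSMul.toLinearMap Rᵐᵒᵖ R b) :=
      lt_of_le_not_ge le_sup_left fun h =>
        hbr₀ (h ((le_sup_right : _ ≤ N ⊔ J.map (DistribSMul.toLinearMap Rᵐᵒᵖ R b)) ⟨r₀, hr₀, rfl⟩))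
    refine hess _ hlt (sup_le hNB ?_) ?_
    · rintro _ ⟨r, -, rfl⟩
      exact mul_mem_of_mem B hb r
    · rintro x ⟨hxC, hx⟩
      obtain ⟨n, hn, _, ⟨r, hr, rfl⟩, rfl⟩ := Submodule.mem_sup.1 hx
      have hbr : r ∈ colon b C := by
        have := C.sub_mem hxC (hNC hn)
        rwa [add_sub_cancel_left] at this
      exact N.add_mem hn (hpb (hle ⟨hbr, hr⟩))
  obtain ⟨S, hS⟩ := IsNoetherian.noetherian B
  have hfin : ∀ T : Finset R, (∀ b ∈ T, b ∈ B) →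
      ∃ I, IsTwoSided I ∧ p < I ∧ ∀ b ∈ T, I ≤ colon b C := by
    classical
    intro T
    induction T using Finset.induction_on with
    | empty => exact fun _ => ⟨⊤, fun _ _ _ => trivial, hp.ne_top.lt_top, by simp⟩
    | insert b T _ ih =>
      intro hT
      obtain ⟨I, hI, hpI, hIT⟩ := ih fun v hv => hT v (by simp [hv])
      obtain ⟨I', hI', hpI', hIb⟩ := hone b (hT b (by simp))
      refine ⟨I ⊓ I', hI.inf hI', hinf _ _ hI' hpI hpI', fun v hv => ?_⟩
      rcases Finset.mem_insert.1 hv with rfl | hv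
      · exact inf_le_right.trans hIb
      · exact inf_le_left.trans (hIT v hv)
  obtain ⟨I, hI, hpI, hIS⟩ := hfin S fun b hb => hS ▸ Submodule.subset_span hb
  refine ⟨I, hI, hpI, fun b hb => ?_⟩
  rw [← hS] at hb
  induction hb using Submodule.span_induction with
  | mem x hx => exact hIS x hx
  | zero => exact fun r _ => by simp
  | add x y _ _ hx hy =>
    intro r hr
    rw [mem_colon, add_mul]
    exact C.add_mem (hx hr) (hy hr)
  | smul a x _ hx =>
    intro r hr
    rw [mem_colon, MulOpposite.smul_eq_mul_unop, mul_assoc]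
    exact hx (hI _ _ hr)

/-- If the sub-bimodule `C / N` is essential in `B / N` as a left module, then `B / C` has a larger
left annihilator than `B / N`, since `B` is finitely generated as a right ideal. -/
theorem exists_mem_leftAnn [IsNoetherian Rᵐᵒᵖ R] {A B C N : Submodule Rᵐᵒᵖ R} (hA : 1 ∉ A)
    (hB : IsTwoSided B) (hC : IsTwoSided C) (hNC : N ≤ C) (hAB : A ≤ leftAnn B N hB)
    (hess : ∀ x ∈ B, x ∉ N → ∃ s, s * x ∈ C ∧ s * x ∉ N) : ∃ u ∈ leftAnn B C hB, u ∉ A := by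
  obtain ⟨S, hS⟩ := IsNoetherian.noetherian B
  have hfin : ∀ T : Finset R, (∀ b ∈ T, b ∈ B) → ∃ u ∉ A, ∀ b ∈ T, u * b ∈ C := by
    classical
    intro T
    induction T using Finset.induction_on with
    | empty => exact fun _ => ⟨1, hA, by simp⟩
    | insert b T _ ih =>
      intro hT
      have hb : b ∈ B := hT b (by simp)
      obtain ⟨u, hu, huT⟩ := ih fun v hv => hT v (by simp [hv])
      by_cases hub : u * b ∈ N
      · refine ⟨u, hu, fun v hv => ?_⟩
        rcases Finset.mem_insert.1 hv with rfl | hv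
        · exact hNC hub
        · exact huT v hv
      · obtain ⟨s, hsC, hsN⟩ := hess _ (hB u b hb) hub
        rw [← mul_assoc] at hsC hsN
        refine ⟨s * u, fun h => hsN (hAB h b hb), fun v hv => ?_⟩
        rcases Finset.mem_insert.1 hv with rfl | hv
        · exact hsC
        · rw [mul_assoc]
          exact hC s _ (huT v hv)
  obtain ⟨u, hu, huS⟩ := hfin S fun b hb => hS ▸ Submodule.subset_span hb
  refine ⟨u, fun b hb => ?_, hu⟩
  rw [← hS] at hb
  induction hb using Submodule.span_induction with
  | mem x hx => exact huS x hx
  | zero => simp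
  | add x y _ _ hx hy =>
    rw [mul_add]
    exact C.add_mem hx hy
  | smul a x _ hx =>
    rw [MulOpposite.smul_eq_mul_unop, ← mul_assoc]
    exact mul_mem_of_mem C hx _

/-- The left annihilator of a nonzero bimodule is prime if all nonzero sub-bimodules have the same
left annihilator. -/
theorem isPrime_of_leftAnn {A B N : Submodule Rᵐᵒᵖ R} (hA : IsTwoSided A) (hB : IsTwoSided B)
    (hN : IsTwoSided N) (hNB : N < B)
    (hann : ∀ C (hC : IsTwoSided C), N < C → C ≤ B → leftAnn C N hC = A) : IsPrime A := by
  have hAB : leftAnn B N hB = A := hann B hB hNB le_rfl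
  refine ⟨hA, fun h => ?_, fun a b hab => ?_⟩
  · obtain ⟨x, hx, hxN⟩ := SetLike.exists_of_lt hNB
    have h1 : (1 : R) ∈ leftAnn B N hB := hAB.symm ▸ h ▸ Submodule.mem_top
    exact hxN (by simpa using h1 x hx)
  by_contra! hnot
  let C : Submodule Rᵐᵒᵖ R := B ⊓ ⨅ r, colon (a * r) N
  have mem_C : ∀ x, x ∈ C ↔ x ∈ B ∧ ∀ r, a * r * x ∈ N := fun x => by simp [C]
  have hC : IsTwoSided C := fun s x hx => by
    rw [mem_C] at hx ⊢
    refine ⟨hB s x hx.1, fun r => ?_⟩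
    have := hx.2 (r * s)
    simpa only [mul_assoc] using this
  have hNC : N ≤ C := fun x hx => (mem_C x).2 ⟨hNB.le hx, fun r => hN _ _ hx⟩
  rcases hNC.eq_or_lt with heq | hlt
  · refine hnot.2 (hAB ▸ fun x hx => heq ▸ (mem_C _).2 ⟨hB b x hx, fun r => ?_⟩)
    rw [← mul_assoc]
    exact (hAB.symm ▸ hab r : a * r * b ∈ leftAnn B N hB) x hx
  · refine hnot.1 (hann C hC hlt inf_le_left ▸ fun x hx => ?_)
    simpa using ((mem_C x).1 hx).2 1

/-- The right annihilator of a nonzero bimodule is prime if all nonzero sub-bimodules have the same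
right annihilator. -/
theorem isPrime_of_rightAnn {p B N : Submodule Rᵐᵒᵖ R} (hB : IsTwoSided B)
    (hN : IsTwoSided N) (hNB : N < B)
    (hann : ∀ C, IsTwoSided C → N < C → C ≤ B → rightAnn C N = p) : IsPrime p := by
  have hBp : rightAnn B N = p := hann B hB hNB le_rfl
  refine ⟨hBp ▸ rightAnn_isTwoSided B N, fun h => ?_, fun a b hab => ?_⟩
  · obtain ⟨x, hx, hxN⟩ := SetLike.exists_of_lt hNB
    have h1 : (1 : R) ∈ rightAnn B N := hBp.symm ▸ h ▸ Submodule.mem_top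
    exact hxN (by simpa using mem_rightAnn.1 h1 x hx)
  by_contra! hnot
  let C : Submodule Rᵐᵒᵖ R :=
    { carrier := {x | x ∈ B ∧ ∀ r, x * r * b ∈ N}
      add_mem' := fun hx hy => ⟨B.add_mem hx.1 hy.1, fun r => by
        rw [add_mul, add_mul]
        exact N.add_mem (hx.2 r) (hy.2 r)⟩
      zero_mem' := ⟨B.zero_mem, fun r => by simp⟩
      smul_mem' := fun c x hx => ⟨B.smul_mem c hx.1, fun r => by
        rw [MulOpposite.smul_eq_mul_unop, mul_assoc x]
        exact hx.2 _⟩ }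
  have hC : IsTwoSided C := fun s x hx => ⟨hB s x hx.1, fun r => by
    rw [mul_assoc, mul_assoc, ← mul_assoc x]
    exact hN s _ (hx.2 r)⟩
  have hNC : N ≤ C := fun x hx => ⟨hNB.le hx, fun r =>
    mul_mem_of_mem N (mul_mem_of_mem N hx r) b⟩
  have hlt : N < C := by
    refine lt_of_le_not_ge hNC fun hle => hnot.1 (hBp ▸ mem_rightAnn.2 fun x hx => ?_)
    refine hle ⟨mul_mem_of_mem B hx a, fun r => ?_⟩
    have := mem_rightAnn.1 (hBp.symm ▸ hab r) x hx
    simpa only [mul_assoc] using this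
  refine hnot.2 (hann C hC hlt (fun x hx => hx.1) ▸ mem_rightAnn.2 fun x hx => ?_)
  simpa using hx.2 1

/-- Let `N ⊆ B` be two-sided ideals of a noetherian right fully bounded ring with `A * B ⊆ N`.
If the ring `R / A` has right dimension `< k`, then so has the right module `B / N`.

The bimodule `B / N` of a bad triple is chosen so that all its nonzero sub-bimodules share its left
and right annihilators, which are then prime, and are essential in it as left modules. If `C` is
essential in `B / N` as a right module, boundedness gives a nonzero sub-bimodule inside `C`. It is
essential on the left, so factoring it out enlarges the left annihilator, hence lowers the dimension
of the ring acting on the left; by induction on `k`, `B / C` has smaller dimension. -/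
theorem devLT_of_mul_mem [IsNoetherian Rᵐᵒᵖ R] [IsNoetherianRing R]
    (hR : ∀ p : Submodule Rᵐᵒᵖ R, IsPrime p → IsBoundedModulo p) {k : ℕ} :
    ∀ {A B N : Submodule Rᵐᵒᵖ R} (_ : IsTwoSided A) (hB : IsTwoSided B) (_ : IsTwoSided N),
      N ≤ B → A ≤ leftAnn B N hB → DevLT k A ⊤ → DevLT k N B := by
  induction k with
  | zero =>
    intro A B N _ hB _ hNB hAB hA
    have hA : A = ⊤ := hA
    refine le_antisymm hNB fun x hx => ?_
    have h1 : (1 : R) ∈ leftAnn B N hB := hAB (hA ▸ Submodule.mem_top)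
    simpa using h1 x hx
  | succ k ih =>
    intro A₀ B₀ N₀ hA₀ hB₀ hN₀ hNB₀ hAB₀ hdim₀
    by_contra hbad₀
    let Bad : Submodule Rᵐᵒᵖ R → Submodule Rᵐᵒᵖ R → Submodule Rᵐᵒᵖ R → Prop := fun A N B =>
      IsTwoSided A ∧ IsTwoSided N ∧ N ≤ B ∧ (∃ hB : IsTwoSided B, A ≤ leftAnn B N hB) ∧
        DevLT (k + 1) A ⊤ ∧ ¬ DevLT (k + 1) N B
    -- `A` maximal, then `N` maximal: nonzero sub-bimodules of `B / N` stay bad, with the same `A`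
    obtain ⟨A, ⟨hexA, hmaxA⟩⟩ := exists_maximal_of_wellFoundedGT
      (fun A => ∃ N B, Bad A N B) ⟨A₀, N₀, B₀, hA₀, hN₀, hNB₀, ⟨hB₀, hAB₀⟩, hdim₀, hbad₀⟩
    obtain ⟨N, ⟨hexN, hmaxN⟩⟩ := exists_maximal_of_wellFoundedGT (fun N => ∃ B, Bad A N B) hexA
    have hsub : ∀ {B C}, Bad A N B → IsTwoSided C → N < C → C ≤ B → Bad A N C := by
      rintro B C ⟨hA, hN, hNB, ⟨hB, hAB⟩, hdim, hbad⟩ hC hNC hCB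
      refine ⟨hA, hN, hNC.le, ⟨hC, fun a ha x hx => hAB ha x (hCB hx)⟩, hdim, fun h => ?_⟩
      refine hbad (DevLT.trans hNC.le hCB h ?_)
      by_contra hCbad
      exact hNC.not_ge (hmaxN ⟨B, hA, hC, hCB, ⟨hB, fun a ha x hx => hNC.le (hAB ha x hx)⟩, hdim,
        hCbad⟩ hNC.le)
    -- among these, one whose right annihilator is as large as possible
    obtain ⟨p, ⟨⟨B₁, hbad₁, hBp₁⟩, hmaxp⟩⟩ := exists_maximal_of_wellFoundedGT
      (fun p => ∃ B, Bad A N B ∧ rightAnn B N = p) ⟨_, hexN.choose, hexN.choose_spec, rfl⟩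
    have hlt₁ : N < B₁ := lt_of_le_of_ne hbad₁.2.2.1 fun h =>
      hbad₁.2.2.2.2.2 (h ▸ DevLT.refl (k + 1) N)
    -- and in it a sub-bimodule all of whose nonzero sub-bimodules are essential on the left
    obtain ⟨D, ⟨⟨B, hB, hNB, hBB₁, hDB⟩, hmaxD⟩⟩ := exists_maximal_of_wellFoundedGT
      (fun D : Ideal R => ∃ C : Submodule Rᵐᵒᵖ R, IsTwoSided C ∧ N < C ∧ C ≤ B₁ ∧
        ∀ x ∈ D, x ∈ C → x ∈ N) ⟨⊥, B₁, hbad₁.2.2.2.1.1, hlt₁, le_rfl, fun x hx _ => by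
          rw [(Submodule.mem_bot R).1 hx]
          exact N.zero_mem⟩
    have hbadB := hsub hbad₁ hB hNB hBB₁
    obtain ⟨hA, hN, -, ⟨_, hAB⟩, hdim, hbad⟩ := id hbadB
    have hless : ∀ C, IsTwoSided C → N < C → C ≤ B → ∀ x ∈ B, x ∉ N →
        ∃ s, s * x ∈ C ∧ s * x ∉ N := by
      intro C hC hNC hCB x hx hxN
      by_contra! hno
      refine hxN (hDB x (hmaxD (y := D ⊔ Ideal.span {x}) ⟨C, hC, hNC, hCB.trans hBB₁, ?_⟩
        le_sup_left ((le_sup_right : _ ≤ D ⊔ Ideal.span {x}) (Ideal.mem_span_singleton_self x))) hx)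
      intro y hy hyC
      obtain ⟨d, hd, z, hz, rfl⟩ := Submodule.mem_sup.1 hy
      obtain ⟨s, rfl⟩ := Ideal.mem_span_singleton'.1 hz
      have hdB : d ∈ B := by simpa using B.sub_mem (hCB hyC) (hB s x hx)
      have hdN : d ∈ N := hDB d hd hdB
      have hsC : s * x ∈ C := by simpa using C.sub_mem hyC (hNC.le hdN)
      exact N.add_mem hdN (hno s hsC)
    have hAprime : IsPrime A := by
      refine isPrime_of_leftAnn hA hB hN hNB fun C hC hNC hCB => ?_
      have hle : A ≤ leftAnn C N hC := fun a ha x hx => hAB ha x (hCB hx)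
      refine le_antisymm (hmaxA ⟨N, C, leftAnn_isTwoSided hC hN, hN, hNC.le, ⟨hC, le_rfl⟩,
        hdim.mono hle le_top le_rfl, (hsub hbadB hC hNC hCB).2.2.2.2.2⟩ hle) hle
    have hann : ∀ C, IsTwoSided C → N < C → C ≤ B → rightAnn C N = p := by
      intro C hC hNC hCB
      have hle : p ≤ rightAnn C N := by
        rw [← hBp₁]
        exact fun a ha => mem_rightAnn.2 fun x hx => mem_rightAnn.1 ha x (hBB₁ (hCB hx))
      exact le_antisymm (hmaxp ⟨C, hsub hbadB hC hNC hCB, rfl⟩ hle) hle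
    have hp : IsPrime p := isPrime_of_rightAnn hB hN hNB hann
    refine hbad (devLT_succ_of_essential hNB.le fun C hNC hCB hess => ?_)
    obtain ⟨I, hI, hpI, hIC⟩ := exists_mul_mem_of_essential hp (hR p hp) hNC hNB.le
      (hann B hB hNB le_rfl) hess
    -- the largest sub-bimodule of `B` contained in `C` contains `B * I`, hence is nonzero
    have hcore : IsTwoSided (core C) := core_isTwoSided C
    have hcoreB : core C ≤ B := (core_le C).trans hCB
    have hNcore : N < core C := by
      refine lt_of_le_not_ge (hN.le_core hNC) fun hle => hpI.not_ge fun r hr => ?_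
      rw [← hann B hB hNB le_rfl, mem_rightAnn]
      refine fun x hx => hle fun s => ?_
      rw [← mul_assoc]
      exact hIC _ (hB s x hx) hr
    have hAle : A ≤ leftAnn B (core C) hB := fun a ha x hx => hNcore.le (hAB ha x hx)
    obtain ⟨u, hu, huA⟩ := exists_mem_leftAnn hAprime.one_notMem hB hcore hNcore.le hAB
      (hless _ hcore hNcore hcoreB)
    have hlt : A < leftAnn B (core C) hB := lt_of_le_not_ge hAle fun hle => huA (hle hu)
    have hann' := leftAnn_isTwoSided hB hcore
    exact (ih hann' hB hcore hcoreB le_rfl (hAprime.devLT_of_lt hann' hlt hdim)).mono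
      (core_le C) hCB le_rfl

/-! ### The families of right ideals -/

/-- Torsion of the class of `1` in `R / I` already provides an element of `I ∩ V`. -/
theorem familyW_subset_familyK (V : Set R) :
    (familyW V : Set (Submodule Rᵐᵒᵖ R)) ⊆ familyK V := by
  intro I hI
  obtain ⟨t, ht, h⟩ := hI (Submodule.Quotient.mk 1)
  rw [← Submodule.Quotient.mk_smul, Submodule.Quotient.mk_eq_zero] at h
  exact ⟨t, by simpa using h, ht⟩

/-- In a noetherian right fully bounded ring, a right ideal `J` that is maximal with
`dim R / J ≥ m` contains a prime ideal `p` with `dim R / p = m`.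

All proper factors of `R / J` have dimension `< m`. The ideal `p` is the associated prime of `R / J`.
If it did not annihilate `R / J`, some ideal `A` with `dim R / A < m` would satisfy `A * p ⊆ J`, and
the bound on the dimension of bimodules would give `dim (J + p) / J < m`, whence `dim R / J < m`. -/
theorem exists_isPrime_le_of_maximal [IsNoetherian Rᵐᵒᵖ R] [IsNoetherianRing R]
    (hR : ∀ p : Submodule Rᵐᵒᵖ R, IsPrime p → IsBoundedModulo p) {m : ℕ}
    {J : Submodule Rᵐᵒᵖ R} (hJ : Maximal (fun J => ¬ DevLT m J ⊤) J) :
    ∃ p, IsPrime p ∧ p ≤ J ∧ DevLT (m + 1) p ⊤ ∧ ¬ DevLT m p ⊤ := by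
  obtain ⟨hJm, hmax⟩ := hJ
  have hgt : ∀ Y, J < Y → DevLT m Y ⊤ := fun Y hY => by
    by_contra h
    exact hY.not_ge (hmax h hY.le)
  have hgt' : ∀ Y, J < Y → ¬ DevLT m J Y := fun Y hY h =>
    hJm (DevLT.trans hY.le le_top h (hgt Y hY))
  have hdim : DevLT (m + 1) J ⊤ := by
    intro f hf hb
    by_cases hall : ∀ i, J < f i
    · exact ⟨0, fun i _ => (hgt _ (hall (i + 1))).mono le_rfl (hf (Nat.le_succ i)) le_top⟩
    · push Not at hall
      obtain ⟨N, hN⟩ := hall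
      have heq : ∀ i, N ≤ i → f i = J := fun i hi =>
        ((hb i).1.eq_of_not_lt fun h => hN (h.trans_le (hf hi))).symm
      exact ⟨N, fun i hi => by
        rw [heq i hi, heq (i + 1) (by omega)]
        exact DevLT.refl m J⟩
  have hJtop : J ≠ ⊤ := fun h => hJm (h ▸ DevLT.refl m _)
  obtain ⟨x, hxJ, p, hp, hpx, hpdim⟩ := exists_isPrime_of_ne_top hR hJtop
  have hJx : J < J ⊔ Submodule.span Rᵐᵒᵖ {x} :=
    lt_of_le_not_ge le_sup_left fun h => hxJ (h (mem_sup_span_self J x))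
  refine ⟨p, hp, ?_, hpdim _ (hdim.mono le_rfl le_sup_left le_top), fun h =>
    hgt' _ hJx (devLT_sup_span (h.mono hpx le_top le_rfl))⟩
  by_contra hpJ
  -- the elements of `R / J` annihilated by `p` form a nonzero submodule `L / J`
  let L : Submodule Rᵐᵒᵖ R :=
    { carrier := {y | p ≤ colon y J}
      add_mem' := fun ha hb r hr => by
        rw [mem_colon, add_mul]
        exact J.add_mem (ha hr) (hb hr)
      zero_mem' := fun r _ => by simp
      smul_mem' := fun c y hy r hr => by
        rw [mem_colon, MulOpposite.smul_eq_mul_unop, mul_assoc]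
        exact hy (hp.isTwoSided _ _ hr) }
  have hJL : J < L := lt_of_le_not_ge (fun y hy r _ => mul_mem_of_mem J hy r) fun h => hxJ (h hpx)
  obtain ⟨A, hA, hAL, hAdim⟩ := exists_isTwoSided_le_of_devLT hR (hgt L hJL)
  have hcore : IsTwoSided (core J ⊓ p) := (core_isTwoSided J).inf hp.isTwoSided
  have hpdev : DevLT m (core J ⊓ p) p := by
    refine devLT_of_mul_mem hR hA hp.isTwoSided hcore inf_le_right (fun a ha y hy => ?_) hAdim
    refine ⟨fun s => ?_, hp.isTwoSided a y hy⟩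
    rw [← mul_assoc]
    exact hAL (hA s a ha) hy
  refine hgt' (J ⊔ p) (lt_of_le_not_ge le_sup_left fun h => hpJ (le_sup_right.trans h))
    (DevLT.sup_left (hpdev.mono (inf_le_inf_right p (core_le J)) inf_le_right le_rfl))

end RightFBN

theorem mainTheorem2 {R : Type*} [Ring R] (hprime : RightFBN.IsPrimeRing R)
    (hnoeth : RightFBN.IsTwoSidedNoetherian R) (n m : ℕ) (hdim : RightFBN.HasKrullDim R R n)
    (hmn : m ≤ n) (X : Set (TwoSidedIdeal R)) (hX : X = RightFBN.fullSet R m)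
    (V : Set R) (hV : V = RightFBN.regularModuloAll X) :
    RightFBN.familyW V ⊆ RightFBN.familyK V ∧
      (RightFBN.IsRightFullyBounded R → RightFBN.familyK V ⊆ RightFBN.familyG R m) := by
  refine ⟨RightFBN.familyW_subset_familyK V, fun hbdd I hI => ?_⟩
  have : IsNoetherian Rᵐᵒᵖ R := RightFBN.isNoetherian_of_isTwoSidedNoetherian hnoeth
  have : IsNoetherianRing R := hnoeth.1
  subst hX hV
  obtain ⟨t, htI, htV⟩ := hI
  refine RightFBN.krullDimLT_quotient_iff.2 ?_
  by_contra hIm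
  obtain ⟨J, ⟨⟨hIJ, hJm⟩, hmax⟩⟩ := exists_maximal_of_wellFoundedGT
    (fun J : Submodule Rᵐᵒᵖ R => I ≤ J ∧ ¬ RightFBN.DevLT m J ⊤) ⟨I, le_rfl, hIm⟩
  have hJ : Maximal (fun J => ¬ RightFBN.DevLT m J ⊤) J :=
    ⟨hJm, fun Y hY hJY => hmax ⟨hIJ.trans hJY, hY⟩ hJY⟩
  obtain ⟨p, hp, hpJ, hpdim, hpm⟩ :=
    RightFBN.exists_isPrime_le_of_maximal (fun _ => hbdd.isBoundedModulo) hJ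
  obtain ⟨q, rfl⟩ := hp.isTwoSided.exists_twoSidedIdeal
  have hqX : q ∈ RightFBN.fullSet R m := ⟨RightFBN.isPrimeIdeal_iff.2 hp,
    RightFBN.krullDimLT_quotient_iff.2 hpdim, fun h => hpm (RightFBN.krullDimLT_quotient_iff.1 h)⟩
  have htq : t ∈ RightFBN.regularModulo q := Set.mem_iInter₂.1 htV q hqX
  -- `J` contains `q + t * R`, while `t` is regular modulo `q`
  refine hJm ((hpdim.sup_span_of_regular fun r => (htq r).1).mono (sup_le hpJ ?_) le_top le_rfl)
  rw [Submodule.span_le, Set.singleton_subset_iff]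
  exact hIJ htI
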